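/- Let $G$ be a profinite group, that is, a compact Hausdorff totally disconnected topological group, and let $Z_m(G)$ denote the $m$-th term of its upper central series ($Z_0(G)=1$ and $Z_{m+1}(G)/Z_m(G)$ is the centre of $G/Z_m(G)$). The following conditions are equivalent. 1. $G$ is covered by countably many nilpotent subgroups, that is, $G$ is the union of a countable (finite or infinite) family of nilpotent subgroups. Here the subgroups may be taken either arbitrary or closed in $G$: the two resulting conditions are equivalent to each other and to the conditions below. 2. $G$ is finite-by-nilpotent, that is, $G$ has a finite normal subgroup $N$ such that $G/N$ is nilpotent. 3. There exists a positive integer $m$ such that $Z_m(G)$ is open in $G$. -/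

import Mathlib

/-- The group `G` is the union of countably many nilpotent subgroups. -/
def CoveredByCountablyManyNilpotent (G : Type*) [Group G] : Prop :=
  ∃ S : Set (Subgroup G), S.Countable ∧ (∀ H ∈ S, Group.IsNilpotent H) ∧
    ∀ g : G, ∃ H ∈ S, g ∈ H

/-- The topological group `G` is the union of countably many closed nilpotent subgroups. -/
def CoveredByCountablyManyClosedNilpotent (G : Type*) [Group G] [TopologicalSpace G] : Prop :=
  ∃ S : Set (Subgroup G), S.Countable ∧
    (∀ H ∈ S, IsClosed (H : Set G) ∧ Group.IsNilpotent H) ∧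
    ∀ g : G, ∃ H ∈ S, g ∈ H

/-- `G` has a finite normal subgroup with nilpotent quotient. -/
def IsFiniteByNilpotent (G : Type*) [Group G] : Prop :=
  ∃ (N : Subgroup G) (_ : N.Normal), Finite N ∧ Group.IsNilpotent (G ⧸ N)

/-! Closures of nilpotent subgroups are nilpotent, so the covering subgroups may be taken closed. By
Baire, every nonempty open set then meets an open member of the cover. The core `N` of one open
member is open, normal and nilpotent, and each coset of `N` contains an element of some open
nilpotent subgroup `H`. Intersect `N` with one such `H` per coset and let `V` be the normal core:
the chosen coset representatives act unipotently on `V`, since `V ≤ H`.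

On each factor of `V ≥ ⁅V, N⁆ ≥ ⁅⁅V, N⁆, N⁆ ≥ ⋯` the finite group `G ⧸ N` acts by unipotent
elements. The algebraic core, `exists_prod_sub_one_eq_zero`, says that a finite group of unipotent
elements of any ring is jointly unipotent. Hence `V` lies in some `Z_m`, which is therefore open.

Conversely, if `Z_m` is open, finitely many nilpotent subgroups `⟨g⟩ Z_m` cover `G`, and Baer's
theorem makes `G` finite-by-nilpotent. If `N` is finite with `G ⧸ N` nilpotent, an open normal
subgroup meeting `N` trivially lies in some `Z_c`. -/

/-! ### Finite groups of unipotent elements in a ring -/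

/-- Let `Q` be a finite `p`-group mapping to a finite ring of characteristic dividing `p`. Then
products of sufficiently many elements `f x - 1` vanish. -/
theorem IsPGroup.exists_prod_sub_one_eq_zero {p : ℕ} [Fact p.Prime] {Q S : Type*} [Group Q]
    [Finite Q] (hQ : IsPGroup p Q) [Ring S] [Finite S] (hp : (p : S) = 0) (f : Q →* S) :
    ∃ m : ℕ, ∀ l : List Q, l.length = m → (l.map fun x => f x - 1).prod = 0 := by
  -- In the finite `p`-group `S ⋊ Q` the commutator of `x` with `s` is `(f x - 1) * s`, so its
  -- nilpotency kills all long products.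
  let φ : Q →* MulAut (Multiplicative S) :=
    (MulAutMultiplicative S).symm.toMonoidHom.comp
      ((DistribMulAction.toAddAut Sˣ S).comp f.toHomUnits)
  have hφ (x : Q) (s : S) : φ x (Multiplicative.ofAdd s) = Multiplicative.ofAdd (f x * s) := rfl
  have hS : IsPGroup p (Multiplicative S) := fun s => ⟨1, by
    change Multiplicative.ofAdd ((p ^ 1) • s.toAdd) = 1
    rw [pow_one, nsmul_eq_mul, hp, zero_mul]; rfl⟩
  have hP : IsPGroup p (Multiplicative S ⋊[φ] Q) := by
    obtain ⟨a, ha⟩ := IsPGroup.iff_card.1 hS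
    obtain ⟨b, hb⟩ := IsPGroup.iff_card.1 hQ
    exact IsPGroup.of_card (n := a + b) (by rw [SemidirectProduct.card, ha, hb, pow_add])
  have : Finite (Multiplicative S ⋊[φ] Q) := Finite.of_equiv _ SemidirectProduct.equivProd.symm
  have hn := hP.isNilpotent
  obtain ⟨m, hm⟩ := Subgroup.nilpotent_iff_lowerCentralSeries.1 hn
  have key : ∀ l : List Q, (SemidirectProduct.inl
      (Multiplicative.ofAdd (l.map fun x => f x - 1).prod) : Multiplicative S ⋊[φ] Q) ∈
      (⊤ : Subgroup (Multiplicative S ⋊[φ] Q)).lowerCentralSeries l.length := by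
    intro l
    induction l with
    | nil => simp
    | cons x l ih =>
      have h := Subgroup.commutator_mem_commutator ih
        (Subgroup.mem_top (SemidirectProduct.inr x : Multiplicative S ⋊[φ] Q))
      rw [← Subgroup.lowerCentralSeries_succ] at h
      have h' := inv_mem h
      rw [commutatorElement_inv, commutatorElement_def, ← map_inv SemidirectProduct.inr,
        ← SemidirectProduct.inl_aut, hφ, ← map_inv, ← map_mul] at h'
      rw [List.length_cons, List.map_cons, List.prod_cons, sub_mul, one_mul, sub_eq_add_neg]
      exact h'
  refine ⟨m, fun l hl => ?_⟩
  have h := key l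
  rw [hl, hm, Subgroup.mem_bot] at h
  have := SemidirectProduct.inl_injective (h.trans (map_one _).symm)
  exact this

theorem exists_prod_sub_one_eq_zero_of_char_prime {p : ℕ} [hpp : Fact p.Prime] {F R : Type*}
    [Group F] [Finite F] [Ring R] (hp : (p : R) = 0) (f : F →* R)
    (hf : ∀ x, IsNilpotent (f x - 1)) :
    ∃ m : ℕ, ∀ l : List F, l.length = m → (l.map fun x => f x - 1).prod = 0 := by
  let Q := f.toHomUnits.range
  rcases subsingleton_or_nontrivial R with hR | hR
  · exact ⟨0, fun _ _ => Subsingleton.elim _ _⟩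
  have : CharP R p := (CharP.charP_iff_prime_eq_zero hpp.out).2 hp
  let : Algebra (ZMod p) R := ZMod.algebra R p
  -- In characteristic `p`, `(f x - 1) ^ p ^ k = f x ^ p ^ k - 1`.
  have hQ : IsPGroup p Q := by
    rintro ⟨_, x, rfl⟩
    obtain ⟨k, hk⟩ := hf x
    refine ⟨k, ?_⟩
    ext
    have h1 : (f x - 1) ^ p ^ k = 0 :=
      pow_eq_zero_of_le (Nat.lt_pow_self hpp.out.one_lt).le hk
    rw [sub_pow_char_pow_of_commute _ _ (Commute.one_right (f x)), one_pow, sub_eq_zero] at h1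
    simpa using h1
  let g : Q →* R := (Units.coeHom R).comp Q.subtype
  have : Finite Q := Finite.of_surjective _ f.toHomUnits.rangeRestrict_surjective
  have : NeZero p := ⟨hpp.out.ne_zero⟩
  -- `R` may be infinite, so the vanishing is proved in the finite group algebra and then mapped to
  -- `R`.
  have : Finite (MonoidAlgebra (ZMod p) Q) :=
    Finite.of_injective (fun a q => a.coeff q : _ → Q → ZMod p)
      (DFunLike.coe_injective.comp MonoidAlgebra.coeff_injective)
  obtain ⟨m, hm⟩ := hQ.exists_prod_sub_one_eq_zero (S := MonoidAlgebra (ZMod p) Q)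
    (by rw [← map_natCast (algebraMap (ZMod p) (MonoidAlgebra (ZMod p) Q)), ZMod.natCast_self,
      map_zero]) (MonoidAlgebra.of (ZMod p) Q)
  refine ⟨m, fun l hl => ?_⟩
  have h := hm (l.map f.toHomUnits.rangeRestrict) (by simpa using hl)
  have h2 := congrArg (MonoidAlgebra.lift (ZMod p) R Q g) h
  rw [map_list_prod, map_zero, List.map_map, List.map_map] at h2
  rw [← h2]
  congr 2
  ext x
  simp [g]

theorem exists_prod_sub_one_eq_natCast_mul {p : ℕ} (hpp : p.Prime) {F R : Type*}
    [Group F] [Finite F] [Ring R] (f : F →* R) (hf : ∀ x, IsNilpotent (f x - 1)) :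
    ∃ m : ℕ, ∀ l : List F, l.length = m → ∃ r : R, (l.map fun x => f x - 1).prod = p * r := by
  have := Fact.mk hpp
  let I : Ideal R := Ideal.span {(p : R)}
  have hI (x : R) : x ∈ I ↔ ∃ r, x = p * r := by
    rw [Ideal.mem_span_singleton']
    exact exists_congr fun r => by rw [eq_comm, (Nat.cast_commute p r).eq]
  have : I.IsTwoSided := ⟨fun {a} b ha => by
    obtain ⟨r, rfl⟩ := (hI a).1 ha
    exact (hI _).2 ⟨r * b, mul_assoc _ _ _⟩⟩
  let π := Ideal.Quotient.mk I
  obtain ⟨m, hm⟩ := exists_prod_sub_one_eq_zero_of_char_prime (p := p) (R := R ⧸ I)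
    (by rw [← map_natCast π]; exact Ideal.Quotient.eq_zero_iff_mem.2 ((hI _).2 ⟨1, by simp⟩))
    ((π : R →* R ⧸ I).comp f) (fun x => by simpa using (hf x).map π)
  refine ⟨m, fun l hl => (hI _).1 (Ideal.Quotient.eq_zero_iff_mem.1 ?_)⟩
  rw [map_list_prod, List.map_map, ← hm l hl]
  rfl

/-- Integers are central, so cutting a long product in two multiplies the divisors; this reduces to
`N` prime. -/
theorem exists_prod_sub_one_eq_natCast_mul_of_ne_zero (N : ℕ) (hN : N ≠ 0) {F R : Type*}
    [Group F] [Finite F] [Ring R] (f : F →* R) (hf : ∀ x, IsNilpotent (f x - 1)) :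
    ∃ m : ℕ, ∀ l : List F, l.length = m → ∃ r : R, (l.map fun x => f x - 1).prod = N * r := by
  induction N using Nat.recOnMul with
  | zero => exact absurd rfl hN
  | one => exact ⟨0, fun l _ => ⟨_, by rw [Nat.cast_one, one_mul]⟩⟩
  | prime p hp => exact exists_prod_sub_one_eq_natCast_mul hp f hf
  | mul a b iha ihb =>
    obtain ⟨m, hm⟩ := iha (left_ne_zero_of_mul hN)
    obtain ⟨n, hn⟩ := ihb (right_ne_zero_of_mul hN)
    refine ⟨m + n, fun l hl => ?_⟩
    obtain ⟨r, hr⟩ := hm (l.take m) (by simp [hl])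
    obtain ⟨s, hs⟩ := hn (l.drop m) (by simp [hl])
    refine ⟨r * s, ?_⟩
    rw [← List.take_append_drop m l, List.map_append, List.prod_append, hr, hs, Nat.cast_mul,
      mul_assoc, mul_assoc, ← mul_assoc r, ← (Nat.cast_commute b r).eq, mul_assoc]

/-- If `x ^ n = 1` and `x - 1` is nilpotent then `x - 1` is killed by a power of `n`. -/
theorem exists_natCast_pow_mul_sub_one_eq_zero {R : Type*} [Ring R] {x : R} {n : ℕ}
    (hx : x ^ n = 1) (hn : IsNilpotent (x - 1)) : ∃ k : ℕ, (n : R) ^ k * (x - 1) = 0 := by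
  obtain ⟨d, hd⟩ := hn
  -- Since `(∑ x ^ i) * (x - 1) = 0`, this gives `n * (x - 1) = -W * (x - 1) ^ 2`, which can be
  -- iterated.
  have hsum : ∃ W : R, Commute W (x - 1) ∧ ∑ i ∈ Finset.range n, x ^ i - n = W * (x - 1) := by
    refine ⟨∑ i ∈ Finset.range n, ∑ j ∈ Finset.range i, x ^ j, ?_, ?_⟩
    · refine Commute.sum_left _ _ _ fun i _ => Commute.sum_left _ _ _ fun j _ => ?_
      exact ((Commute.refl x).sub_right (Commute.one_right x)).pow_left j
    · rw [Finset.sum_mul]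
      simp_rw [geom_sum_mul]
      simp
  obtain ⟨W, hW, hs⟩ := hsum
  have h1 : (n : R) * (x - 1) = -(W * (x - 1)) * (x - 1) := by
    have := geom_sum_mul x n
    rw [hx, sub_self, sub_eq_iff_eq_add.1 hs, add_mul] at this
    rw [neg_mul]
    exact eq_neg_of_add_eq_zero_right this
  have h2 (k : ℕ) : (n : R) ^ k * (x - 1) = (-(W * (x - 1))) ^ k * (x - 1) := by
    induction k with
    | zero => simp
    | succ k ih =>
      rw [pow_succ', mul_assoc, ih, ← mul_assoc, (Nat.cast_commute n _).eq, mul_assoc, h1,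
        ← mul_assoc, ← pow_succ]
  refine ⟨d, ?_⟩
  rw [h2, neg_pow, hW.mul_pow, hd]
  simp

/-- A finite group of unipotent elements of a ring is unipotent: products of sufficiently many
elements `f x - 1` vanish. -/
theorem exists_prod_sub_one_eq_zero {F R : Type*} [Group F] [Finite F] [Ring R] (f : F →* R)
    (hf : ∀ x, IsNilpotent (f x - 1)) :
    ∃ m : ℕ, ∀ l : List F, l.length = m → (l.map fun x => f x - 1).prod = 0 := by
  have h1 (x : F) : ∃ k : ℕ, (Nat.card F : R) ^ k * (f x - 1) = 0 :=
    exists_natCast_pow_mul_sub_one_eq_zero (by rw [← map_pow, pow_card_eq_one', map_one]) (hf x)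
  choose k hk using h1
  obtain ⟨K, hK⟩ := (Set.finite_range k).bddAbove
  have h2 (x : F) : ((Nat.card F ^ K : ℕ) : R) * (f x - 1) = 0 := by
    have hle : k x ≤ K := hK ⟨x, rfl⟩
    rw [Nat.cast_pow, ← Nat.sub_add_cancel hle, pow_add, mul_assoc, hk, mul_zero]
  -- A product of `m` factors is divisible by `Nat.card F ^ K`, which annihilates one further
  -- factor.
  obtain ⟨m, hm⟩ := exists_prod_sub_one_eq_natCast_mul_of_ne_zero (Nat.card F ^ K)
    (pow_ne_zero _ Nat.card_pos.ne') f hf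
  refine ⟨m + 1, fun l hl => ?_⟩
  match l, hl with
  | x :: l, hl =>
    obtain ⟨r, hr⟩ := hm l (by simpa using hl)
    rw [List.map_cons, List.prod_cons, hr, ← mul_assoc, ← (Nat.cast_commute _ (f x - 1)).eq, h2,
      zero_mul]

/-! ### Iterated commutators and unipotent conjugation actions -/

namespace Subgroup

open scoped commutatorElement IsMulCommutative

variable {G : Type*} [Group G]

/-- The iterated commutator `⁅⁅⋯⁅A, K⁆, K⁆⋯, K⁆` with `n` factors `K`. -/
def iteratedCommutator (A K : Subgroup G) : ℕ → Subgroup G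
  | 0 => A
  | n + 1 => ⁅iteratedCommutator A K n, K⁆

theorem iteratedCommutator_zero (A K : Subgroup G) : A.iteratedCommutator K 0 = A := rfl

theorem iteratedCommutator_succ (A K : Subgroup G) (n : ℕ) :
    A.iteratedCommutator K (n + 1) = ⁅A.iteratedCommutator K n, K⁆ := rfl

instance iteratedCommutator_normal (A K : Subgroup G) [A.Normal] [K.Normal] (n : ℕ) :
    (A.iteratedCommutator K n).Normal := by
  induction n with
  | zero => assumption
  | succ n _ => rw [iteratedCommutator_succ]; infer_instance

theorem iteratedCommutator_mono {A B K L : Subgroup G} (h : A ≤ B) (hK : K ≤ L) (n : ℕ) :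
    A.iteratedCommutator K n ≤ B.iteratedCommutator L n := by
  induction n with
  | zero => exact h
  | succ n ih => exact commutator_mono ih hK

theorem iteratedCommutator_add (A K : Subgroup G) (m n : ℕ) :
    A.iteratedCommutator K (m + n) = (A.iteratedCommutator K m).iteratedCommutator K n := by
  induction n with
  | zero => rfl
  | succ n ih => rw [← add_assoc, iteratedCommutator_succ, ih, iteratedCommutator_succ]

theorem iteratedCommutator_le_left (A K : Subgroup G) [A.Normal] [K.Normal] (n : ℕ) :
    A.iteratedCommutator K n ≤ A := by
  induction n with
  | zero => exact le_rfl
  | succ n ih => exact (commutator_le_left _ _).trans ih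

theorem map_iteratedCommutator {H : Type*} [Group H] (f : G →* H) (A K : Subgroup G) (n : ℕ) :
    (A.iteratedCommutator K n).map f = (A.map f).iteratedCommutator (K.map f) n := by
  induction n with
  | zero => rfl
  | succ n ih => rw [iteratedCommutator_succ, map_commutator, ih, iteratedCommutator_succ]

theorem iteratedCommutator_le_lowerCentralSeries {A K : Subgroup G} (h : A ≤ K) (n : ℕ) :
    A.iteratedCommutator K n ≤ K.lowerCentralSeries n := by
  induction n with
  | zero => exact h
  | succ n ih => exact commutator_mono ih le_rfl

theorem le_upperCentralSeries_of_iteratedCommutator_le {A : Subgroup G} {m j : ℕ}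
    (h : A.iteratedCommutator ⊤ m ≤ upperCentralSeries G j) :
    A ≤ upperCentralSeries G (m + j) := by
  induction m generalizing j with
  | zero => rwa [zero_add]
  | succ m ih =>
    rw [add_assoc, add_comm 1]
    refine ih fun x hx => mem_upperCentralSeries_succ_iff.2 fun y => h ?_
    exact commutator_mem_commutator hx (mem_top y)

theorem iteratedCommutator_eq_bot_of_le_upperCentralSeries {A : Subgroup G} {m : ℕ}
    (h : A ≤ upperCentralSeries G m) : A.iteratedCommutator ⊤ m = ⊥ := by
  have key : ∀ i j, i + j = m → A.iteratedCommutator ⊤ i ≤ upperCentralSeries G j := by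
    intro i
    induction i with
    | zero => rintro j rfl; rwa [zero_add] at h
    | succ i ih =>
      intro j hj
      exact (commutator_mono (ih (j + 1) (by omega)) le_rfl).trans
        (commutator_upperCentralSeries_top_le G j)
  exact le_bot_iff.1 (key m 0 rfl)

/-- The iterates of `⁅x, ·⁆`, for `x` in a subgroup `H`, lie in the lower central series. -/
theorem iterate_commutatorElement_mem_lowerCentralSeries {H : Subgroup G} {x v : G} (hx : x ∈ H)
    (hv : v ∈ H) (d : ℕ) : (fun w => ⁅x, w⁆)^[d] v ∈ H.lowerCentralSeries d := by
  induction d with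
  | zero => exact hv
  | succ d ih =>
    rw [Function.iterate_succ_apply', ← commutatorElement_inv]
    exact inv_mem (commutator_mem_commutator ih hx)

/-- The action by conjugation on an abelian normal subgroup, as endomorphisms. -/
def conjEnd (A : Subgroup G) [A.Normal] [IsMulCommutative A] :
    G →* AddMonoid.End (Additive A) where
  toFun g := MonoidHom.toAdditive (MulAut.conjNormal g : MulAut A).toMonoidHom
  map_one' := by rw [map_one]; rfl
  map_mul' g h := by rw [map_mul]; rfl

theorem coe_conjEnd_sub_one_apply (A : Subgroup G) [A.Normal] [IsMulCommutative A] (g : G)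
    (a : Additive A) : (((conjEnd A g - 1) a).toMul : G) = ⁅g, (a.toMul : G)⁆ := by
  have h : (conjEnd A g - 1) a = conjEnd A g a - a :=
    AddMonoidHom.sub_apply (conjEnd A g) (1 : AddMonoid.End (Additive A)) a
  rw [h, commutatorElement_def, sub_eq_add_neg]
  rfl

theorem mem_upperCentralSeries_of_forall_list (A : Subgroup G) [A.Normal] [IsMulCommutative A]
    (m : ℕ) (a : Additive A)
    (h : ∀ l : List G, l.length = m → (l.map fun x => conjEnd A x - 1).prod a = 0) :
    (a.toMul : G) ∈ upperCentralSeries G m := by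
  induction m generalizing a with
  | zero =>
    have : a = 0 := by simpa using h [] rfl
    rw [this]
    exact one_mem _
  | succ m ih =>
    rw [mem_upperCentralSeries_succ_iff]
    intro g
    rw [← commutatorElement_inv, ← coe_conjEnd_sub_one_apply]
    refine inv_mem (ih _ fun l hl => ?_)
    have := h (l ++ [g]) (by simp [hl])
    rwa [List.map_append, List.prod_append, List.map_singleton, List.prod_singleton] at this

/-- An abelian normal subgroup centralized by a subgroup `N` of finite index, on which every coset
of `N` has a representative acting unipotently, is contained in a term of the upper central
series. -/
theorem exists_le_upperCentralSeries_of_commutator_eq_bot {A N : Subgroup G} [A.Normal] [N.Normal]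
    [N.FiniteIndex] (hAN : A ≤ N) (hcomm : ⁅A, N⁆ = ⊥)
    (hu : ∀ g : G, ∃ n ∈ N, ∃ d : ℕ, ∀ a ∈ A, (fun v => ⁅g * n, v⁆)^[d] a = 1) :
    ∃ m, A ≤ upperCentralSeries G m := by
  have hc := commutator_eq_bot_iff_le_centralizer.1 hcomm
  have : IsMulCommutative A :=
    commutator_self_eq_bot_iff.1 (le_bot_iff.1 ((commutator_mono le_rfl hAN).trans hcomm.le))
  -- The action factors through the finite group `G ⧸ N`, where `g` and `g * n` agree.
  have hker : N ≤ (conjEnd A).ker := by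
    intro n hn
    rw [MonoidHom.mem_ker]
    ext a
    have h : n * a.toMul = a.toMul * n := hc a.toMul.2 n hn
    change n * a.toMul * n⁻¹ = a.toMul
    rw [h, mul_inv_cancel_right]
  let f : G ⧸ N →* AddMonoid.End (Additive A) := QuotientGroup.lift N (conjEnd A) hker
  have hf (g : G) : f (g : G ⧸ N) = conjEnd A g := rfl
  have hnil (q : G ⧸ N) : IsNilpotent (f q - 1) := by
    obtain ⟨g, rfl⟩ := QuotientGroup.mk_surjective q
    obtain ⟨n, hn, d, hd⟩ := hu g
    refine ⟨d, ?_⟩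
    have : (g : G ⧸ N) = ((g * n : G) : G ⧸ N) := (QuotientGroup.mk_mul_of_mem g hn).symm
    rw [this, hf]
    have key (k : ℕ) (a : Additive A) : ((((conjEnd A (g * n) - 1) ^ k) a).toMul : G) =
        (fun v : G => ⁅g * n, v⁆)^[k] (a.toMul : G) := by
      induction k with
      | zero => rfl
      | succ k ih =>
        rw [Function.iterate_succ_apply', ← ih, ← coe_conjEnd_sub_one_apply, pow_succ']
        rfl
    ext a
    rw [key, hd _ a.toMul.2]
    rfl
  obtain ⟨m, hm⟩ := exists_prod_sub_one_eq_zero f hnil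
  refine ⟨m, fun a ha => ?_⟩
  refine mem_upperCentralSeries_of_forall_list A m (Additive.ofMul ⟨a, ha⟩) fun l hl => ?_
  have := hm (l.map (QuotientGroup.mk' N)) (by simpa using hl)
  rw [List.map_map] at this
  exact DFunLike.congr_fun this _

theorem map_iterate_commutatorElement {H : Type*} [Group H] (f : G →* H) (x v : G) (d : ℕ) :
    (fun w => ⁅f x, w⁆)^[d] (f v) = f ((fun w => ⁅x, w⁆)^[d] v) :=
  ((Function.Semiconj.iterate_right (fun w => map_commutatorElement f x w) d) v).symm

/-- In `G ⧸ B` the image of `N` centralizes that of `A`, so the abelian case applies. -/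
theorem exists_iteratedCommutator_top_le {A B N : Subgroup G} [A.Normal] [B.Normal] [N.Normal]
    [N.FiniteIndex] (hAN : A ≤ N) (hcomm : ⁅A, N⁆ ≤ B)
    (hu : ∀ g : G, ∃ n ∈ N, ∃ d : ℕ, ∀ a ∈ A, (fun v => ⁅g * n, v⁆)^[d] a = 1) :
    ∃ m, A.iteratedCommutator ⊤ m ≤ B := by
  let π := QuotientGroup.mk' B
  have hπ : Function.Surjective π := QuotientGroup.mk'_surjective B
  have hA : (A.map π).Normal := Normal.map ‹_› _ hπ
  have hN : (N.map π).Normal := Normal.map ‹_› _ hπ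
  have hfin : (N.map π).FiniteIndex :=
    ⟨fun h => FiniteIndex.index_ne_zero (H := N)
      (Nat.eq_zero_of_zero_dvd (h ▸ index_map_dvd N hπ))⟩
  obtain ⟨m, hm⟩ := exists_le_upperCentralSeries_of_commutator_eq_bot (A := A.map π)
    (N := N.map π) (map_mono hAN)
    (by
      rw [← map_commutator, map_eq_bot_iff, QuotientGroup.ker_mk']
      exact hcomm)
    (by
      intro g
      obtain ⟨g, rfl⟩ := hπ g
      obtain ⟨n, hn, d, hd⟩ := hu g
      refine ⟨π n, mem_map_of_mem π hn, d, ?_⟩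
      rintro _ ⟨a, ha, rfl⟩
      rw [← map_mul, map_iterate_commutatorElement, hd a ha, map_one])
  refine ⟨m, ?_⟩
  have h := iteratedCommutator_eq_bot_of_le_upperCentralSeries hm
  rw [← map_top_of_surjective π hπ, ← map_iteratedCommutator, map_eq_bot_iff,
    QuotientGroup.ker_mk'] at h
  exact h

/-- Let `V ≤ N` be normal subgroups with `N` nilpotent of finite index. If every coset of `N` has a
representative acting unipotently on `V`, then `V` is contained in a term of the upper central
series. -/
theorem exists_le_upperCentralSeries {V N : Subgroup G} [V.Normal] [N.Normal] [N.FiniteIndex]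
    [hN : Group.IsNilpotent N] (hVN : V ≤ N)
    (hu : ∀ g : G, ∃ n ∈ N, ∃ d : ℕ, ∀ v ∈ V, (fun w => ⁅g * n, w⁆)^[d] v = 1) :
    ∃ m, V ≤ upperCentralSeries G m := by
  obtain ⟨c, hc⟩ := (isNilpotent_iff_lowerCentralSeries N).1 hN
  -- The series `V.iteratedCommutator N i` reaches `⊥` because `N` is nilpotent.
  have key (i : ℕ) : ∃ m, V.iteratedCommutator ⊤ m ≤ V.iteratedCommutator N i := by
    induction i with
    | zero => exact ⟨0, le_rfl⟩
    | succ i ih =>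
      obtain ⟨m, hm⟩ := ih
      have hle := iteratedCommutator_le_left V N i
      obtain ⟨k, hk⟩ := exists_iteratedCommutator_top_le (A := V.iteratedCommutator N i)
        (B := V.iteratedCommutator N (i + 1)) (hle.trans hVN) le_rfl
        (fun g => by
          obtain ⟨n, hn, d, hd⟩ := hu g
          exact ⟨n, hn, d, fun a ha => hd a (hle ha)⟩)
      refine ⟨m + k, ?_⟩
      rw [iteratedCommutator_add]
      exact (iteratedCommutator_mono hm le_rfl k).trans hk
  obtain ⟨m, hm⟩ := key c
  refine ⟨m + 0, le_upperCentralSeries_of_iteratedCommutator_le ?_⟩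
  exact hm.trans ((iteratedCommutator_le_lowerCentralSeries hVN c).trans (hc.le.trans bot_le))

end Subgroup

/-! ### Baer's theorem -/

namespace Subgroup

open scoped commutatorElement IsMulCommutative

variable {G : Type*} [Group G]

/-- The three subgroups lemma modulo a normal subgroup. -/
theorem commutator_commutator_le_of_rotate {H₁ H₂ H₃ K : Subgroup G} [K.Normal]
    (h₁ : ⁅⁅H₂, H₃⁆, H₁⁆ ≤ K) (h₂ : ⁅⁅H₃, H₁⁆, H₂⁆ ≤ K) : ⁅⁅H₁, H₂⁆, H₃⁆ ≤ K := by
  have key (A B C : Subgroup G) : ⁅⁅A, B⁆, C⁆ ≤ K ↔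
      ⁅⁅A.map (QuotientGroup.mk' K), B.map (QuotientGroup.mk' K)⁆,
        C.map (QuotientGroup.mk' K)⁆ = ⊥ := by
    rw [← map_commutator, ← map_commutator, map_eq_bot_iff, QuotientGroup.ker_mk']
  rw [key] at *
  exact commutator_commutator_eq_bot_of_rotate h₁ h₂

/-- Induction by three subgroups. The case `j = 0` supplies the centralizer of finite index in
Baer's theorem. -/
theorem commutator_lowerCentralSeries_upperCentralSeries_le (i j : ℕ) :
    ⁅(⊤ : Subgroup G).lowerCentralSeries i, upperCentralSeries G (i + 1 + j)⁆ ≤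
      upperCentralSeries G j := by
  induction i generalizing j with
  | zero =>
    rw [zero_add, add_comm, commutator_comm]
    exact commutator_upperCentralSeries_top_le G j
  | succ i ih =>
    rw [lowerCentralSeries_succ]
    refine commutator_commutator_le_of_rotate ?_ ?_
    · rw [commutator_comm ⊤, commutator_comm _ (lowerCentralSeries ⊤ i)]
      refine (commutator_mono le_rfl ?_).trans (ih j)
      have := commutator_upperCentralSeries_top_le G (i + 1 + j)
      rwa [show i + 1 + j + 1 = i + 1 + 1 + j by ring] at this
    · rw [commutator_comm _ (lowerCentralSeries ⊤ i)]
      have := ih (j + 1)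
      rw [show i + 1 + (j + 1) = i + 1 + 1 + j by ring] at this
      exact (commutator_mono this le_rfl).trans (commutator_upperCentralSeries_top_le G j)

theorem finite_of_finite_map {H : Type*} [Group H] {f : G →* H} {L : Subgroup G}
    (hker : Finite f.ker) (hL : Finite (L.map f)) : Finite L := by
  have hfib (b : H) : (f ⁻¹' {b}).Finite := by
    rcases (f ⁻¹' {b}).eq_empty_or_nonempty with h | ⟨a, ha⟩
    · rw [h]; exact Set.finite_empty
    · refine ((Set.toFinite (f.ker : Set G)).image (a * ·)).subset fun x hx => ?_
      refine ⟨a⁻¹ * x, ?_, mul_inv_cancel_left a x⟩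
      rw [SetLike.mem_coe, MonoidHom.mem_ker, map_mul, map_inv, Set.mem_singleton_iff.1 ha,
        Set.mem_singleton_iff.1 hx, inv_mul_cancel]
  have h : (f ⁻¹' (L.map f : Set H)).Finite :=
    (Set.toFinite (L.map f : Set H)).preimage' fun b _ => hfib b
  exact (h.subset fun x hx => mem_map_of_mem f hx).to_subtype

theorem commutatorElement_pow_left {K : Subgroup G} [K.Normal] (hK : IsMulCommutative K) {k : G}
    (hk : k ∈ K) (g : G) (e : ℕ) : ⁅k ^ e, g⁆ = ⁅k, g⁆ ^ e := by
  induction e with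
  | zero => simp
  | succ e ih =>
    have hmem : ⁅k, g⁆ ^ e ∈ K :=
      pow_mem (commutator_le_left K ⊤ (commutator_mem_commutator hk (mem_top g))) e
    have hcomm : k * ⁅k, g⁆ ^ e = ⁅k, g⁆ ^ e * k :=
      congrArg Subtype.val (mul_comm (⟨k, hk⟩ : K) ⟨_, hmem⟩)
    rw [pow_succ', commutatorElement_mul_left_eq_conj_mul, ih, hcomm, mul_inv_cancel_right,
      pow_succ]

/-- `⁅K, ⊤⁆` is abelian and finitely generated by elements of exponent `e`. -/
theorem finite_commutator_top_of_isMulCommutative {K : Subgroup G} [K.Normal]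
    (hK : IsMulCommutative K) (hS : {x | ∃ k ∈ K, ∃ g ∈ (⊤ : Subgroup G), ⁅k, g⁆ = x}.Finite)
    {e : ℕ} (he : e ≠ 0) (hpow : ∀ k ∈ K, ∀ g : G, ⁅k, g⁆ ^ e = 1) :
    Finite (⁅K, ⊤⁆ : Subgroup G) := by
  have hle : ⁅K, ⊤⁆ ≤ K := commutator_le_left K ⊤
  have hL : IsMulCommutative (⁅K, ⊤⁆ : Subgroup G) :=
    commutator_self_eq_bot_iff.1
      (le_bot_iff.1 ((commutator_mono hle hle).trans (commutator_self_eq_bot_iff.2 hK).le))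
  have htors : ∀ y ∈ (⁅K, ⊤⁆ : Subgroup G), y ^ e = 1 := by
    intro y hy
    refine closure_induction ?_ (one_pow e) ?_ ?_ hy
    · rintro _ ⟨k, hk, g, -, rfl⟩
      exact hpow k hk g
    · intro x y hx hy hxe hye
      have hxy : Commute x y := congrArg Subtype.val
        (mul_comm (⟨x, hx⟩ : (⁅K, ⊤⁆ : Subgroup G)) (⟨y, hy⟩ : (⁅K, ⊤⁆ : Subgroup G)))
      rw [hxy.mul_pow, hxe, hye, mul_one]
    · intro x _ hx
      rw [inv_pow, hx, inv_one]
  have : Group.FG (⁅K, ⊤⁆ : Subgroup G) :=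
    (Group.fg_iff_subgroup_fg _).2 ((Subgroup.fg_iff _).2 ⟨_, rfl, hS⟩)
  refine CommGroup.finite_of_fg_isMulTorsion _ fun y => ?_
  exact isOfFinOrder_iff_pow_eq_one.2
    ⟨e, Nat.pos_of_ne_zero he, Subtype.ext (htors y y.2)⟩

/-- `⁅k, g⁆` depends only on `k` modulo the centre and on `g` modulo the centralizer of `K`. -/
theorem finite_setOf_commutatorElement {K : Subgroup G} (hC : (center G).relIndex K ≠ 0)
    [hT : (centralizer (K : Set G)).FiniteIndex] :
    {x | ∃ k ∈ K, ∃ g ∈ (⊤ : Subgroup G), ⁅k, g⁆ = x}.Finite := by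
  have : ((center G).subgroupOf K).FiniteIndex := ⟨hC⟩
  let Φ : (K ⧸ (center G).subgroupOf K) × (G ⧸ centralizer (K : Set G)) → G :=
    fun q => ⁅(q.1.out : G), q.2.out⁆
  refine (Set.finite_range Φ).subset ?_
  rintro _ ⟨k, hk, g, -, rfl⟩
  refine ⟨(((⟨k, hk⟩ : K) : K ⧸ (center G).subgroupOf K), (g : G ⧸ centralizer (K : Set G))), ?_⟩
  obtain ⟨c, hc⟩ := QuotientGroup.mk_out_eq_mul ((center G).subgroupOf K) (⟨k, hk⟩ : K)
  obtain ⟨t, ht⟩ := QuotientGroup.mk_out_eq_mul (centralizer (K : Set G)) g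
  have hc' : ((c : K) : G) ∈ center G := c.2
  have hcc := mem_center_iff.1 hc'
  have htk : k * t = t * k := t.2 k hk
  simp only [Φ, hc, ht, coe_mul, commutatorElement_def]
  rw [mul_assoc k, ← hcc, mul_inv_rev k, mul_inv_rev g]
  have htk' : (t : G) * k⁻¹ * (t : G)⁻¹ = k⁻¹ := by
    rw [mul_inv_eq_iff_eq_mul, eq_inv_mul_iff_mul_eq, ← mul_assoc, htk, mul_inv_cancel_right]
  calc k * (g * t * (c : K)) * (((c : K) : G)⁻¹ * k⁻¹) * ((t : G)⁻¹ * g⁻¹)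
      = k * g * (t * k⁻¹ * (t : G)⁻¹) * g⁻¹ := by group
    _ = _ := by rw [htk']

/-- Finitely many commutators make `⁅K, K⁆` finite (Schur); dividing by it makes `K` abelian. -/
theorem finite_commutator_top {K : Subgroup G} [K.Normal] (hC : (center G).relIndex K ≠ 0)
    [hT : (centralizer (K : Set G)).FiniteIndex] : Finite (⁅K, ⊤⁆ : Subgroup G) := by
  have hS := finite_setOf_commutatorElement hC
  have hKset : Finite (commutatorSet K) := by
    refine (Set.Finite.of_finite_image (f := Subtype.val) (hS.subset ?_)
      Subtype.val_injective.injOn).to_subtype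
    rintro _ ⟨_, ⟨a, b, rfl⟩, rfl⟩
    exact ⟨a, a.2, b, mem_top _, rfl⟩
  have hKK : Finite (⁅K, K⁆ : Subgroup G) := by
    rw [← map_subtype_commutator]
    have : Finite (_root_.commutator K) := inferInstance
    exact (Set.Finite.image K.subtype this).to_subtype
  let π := QuotientGroup.mk' ⁅K, K⁆
  have hπ : Function.Surjective π := QuotientGroup.mk'_surjective _
  have hn : (K.map π).Normal := Normal.map ‹_› _ hπ
  refine finite_of_finite_map (f := π) (by rwa [QuotientGroup.ker_mk']) ?_
  rw [map_commutator, map_top_of_surjective π hπ]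
  have hab : IsMulCommutative (K.map π) := by
    rw [← commutator_self_eq_bot_iff, ← map_commutator, map_eq_bot_iff, QuotientGroup.ker_mk']
  -- The exponent is `e = (center G).relIndex K`: `⁅k, g⁆ ^ e = ⁅k ^ e, g⁆` modulo `⁅K, K⁆`, and `k
  -- ^ e` is central.
  refine finite_commutator_top_of_isMulCommutative hab ((hS.image π).subset ?_) hC ?_
  · rintro _ ⟨_, ⟨k, hk, rfl⟩, g, -, rfl⟩
    obtain ⟨g, rfl⟩ := hπ g
    exact ⟨⁅k, g⁆, ⟨k, hk, g, mem_top g, rfl⟩, map_commutatorElement π k g⟩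
  · rintro _ ⟨k, hk, rfl⟩ g
    obtain ⟨g, rfl⟩ := hπ g
    rw [← commutatorElement_pow_left hab (mem_map_of_mem π hk), ← map_pow,
      ← map_commutatorElement]
    have hmem : k ^ (center G).relIndex K ∈ center G :=
      ((center G).subgroupOf K).pow_index_mem (⟨k, hk⟩ : K)
    rw [commutatorElement_eq_one_iff_mul_comm.2 (mem_center_iff.1 hmem g).symm, map_one]

/-- **Baer's theorem**: if a term of the upper central series has finite index, then the
corresponding term of the lower central series is finite. -/
theorem finite_lowerCentralSeries_of_finiteIndex_upperCentralSeries {G : Type*} [Group G] (m : ℕ)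
    (h : (upperCentralSeries G m).FiniteIndex) :
    Finite ((⊤ : Subgroup G).lowerCentralSeries m) := by
  induction m generalizing G with
  | zero =>
    have h0 := h.index_ne_zero
    rw [upperCentralSeries_zero, index_bot] at h0
    have := Nat.finite_of_card_ne_zero h0
    infer_instance
  | succ m ih =>
    have hfin : (upperCentralSeries (G ⧸ center G) m).FiniteIndex := ⟨by
      rw [← index_comap_of_surjective _ (QuotientGroup.mk'_surjective (center G)),
        comap_upperCentralSeries_quotient_center]
      exact h.index_ne_zero⟩
    have hK := ih hfin
    rw [← map_top_of_surjective _ (QuotientGroup.mk'_surjective (center G)),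
      ← map_lowerCentralSeries] at hK
    have hC : (center G).relIndex ((⊤ : Subgroup G).lowerCentralSeries m) ≠ 0 := by
      have := relIndex_ker ((⊤ : Subgroup G).lowerCentralSeries m) (QuotientGroup.mk' (center G))
      rw [QuotientGroup.ker_mk'] at this
      rw [this]
      exact Nat.card_pos.ne'
    have hT : (centralizer ((⊤ : Subgroup G).lowerCentralSeries m : Set G)).FiniteIndex := by
      refine finiteIndex_of_le (H := upperCentralSeries G (m + 1)) ?_
      rw [← commutator_eq_bot_iff_le_centralizer, commutator_comm]
      exact le_bot_iff.1 (commutator_lowerCentralSeries_upperCentralSeries_le m 0)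
    exact finite_commutator_top hC

end Subgroup

/-! ### Nilpotent subgroups, closures and open subgroups -/

namespace Subgroup

open scoped commutatorElement

section Nilpotent

variable {G : Type*} [Group G]

theorem isNilpotent_of_le {H K : Subgroup G} (h : H ≤ K) (hK : Group.IsNilpotent K) :
    Group.IsNilpotent H := by
  rw [isNilpotent_iff_lowerCentralSeries] at *
  obtain ⟨n, hn⟩ := hK
  exact ⟨n, le_bot_iff.1 ((lowerCentralSeries_mono n h).trans hn.le)⟩

/-- `H` is cyclic modulo `Z`, so `⁅H, H⁆ ≤ Z`, and `m` further commutators reach `⊥`. -/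
theorem isNilpotent_zpowers_sup_upperCentralSeries (g : G) (m : ℕ) :
    Group.IsNilpotent (zpowers g ⊔ upperCentralSeries G m : Subgroup G) := by
  set Z := upperCentralSeries G m
  set H := zpowers g ⊔ Z
  have h1 : ⁅H, H⁆ ≤ Z := by
    have hmap : H.map (QuotientGroup.mk' Z) = zpowers (QuotientGroup.mk' Z g) := by
      rw [map_sup, MonoidHom.map_zpowers,
        (map_eq_bot_iff Z).2 (QuotientGroup.ker_mk' Z).ge, sup_bot_eq]
    have h2 : (⁅H, H⁆ : Subgroup G).map (QuotientGroup.mk' Z) = ⊥ := by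
      rw [map_commutator, hmap, commutator_self_eq_bot_iff]
      infer_instance
    rwa [map_eq_bot_iff, QuotientGroup.ker_mk'] at h2
  have h3 (n : ℕ) : H.lowerCentralSeries (n + 1) ≤ Z.iteratedCommutator ⊤ n := by
    induction n with
    | zero => exact h1
    | succ n ih => exact commutator_mono ih le_top
  refine (isNilpotent_iff_lowerCentralSeries H).2 ⟨m + 1, le_bot_iff.1 ((h3 m).trans ?_)⟩
  exact (iteratedCommutator_eq_bot_of_le_upperCentralSeries le_rfl).le

end Nilpotent

section Topology

variable {G : Type*} [Group G] [TopologicalSpace G] [IsTopologicalGroup G]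

theorem lowerCentralSeries_topologicalClosure_le (H : Subgroup G) (n : ℕ) :
    H.topologicalClosure.lowerCentralSeries n ≤ (H.lowerCentralSeries n).topologicalClosure := by
  induction n with
  | zero => exact le_rfl
  | succ n ih =>
    refine commutator_le.2 fun x hx y hy => ?_
    refine map_mem_closure₂ (f := fun a b : G => ⁅a, b⁆) ?_ (ih hx) hy
      fun a ha b hb => commutator_mem_commutator ha hb
    simp only [Function.uncurry_def, commutatorElement_def]
    fun_prop

theorem isNilpotent_topologicalClosure [T1Space G] {H : Subgroup G} (hH : Group.IsNilpotent H) :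
    Group.IsNilpotent H.topologicalClosure := by
  rw [isNilpotent_iff_lowerCentralSeries] at *
  obtain ⟨n, hn⟩ := hH
  refine ⟨n, le_bot_iff.1 ((lowerCentralSeries_topologicalClosure_le H n).trans ?_)⟩
  rw [hn]
  exact topologicalClosure_minimal _ le_rfl (by simp)

theorem isOpen_normalCore [CompactSpace G] {H : Subgroup G} (hH : IsOpen (H : Set G)) :
    IsOpen (H.normalCore : Set G) := by
  have := H.quotient_finite_of_isOpen hH
  have : H.FiniteIndex := H.finiteIndex_of_finite_quotient
  exact isOpen_of_isClosed_of_finiteIndex _ (H.normalCore_isClosed (H.isClosed_of_isOpen hH))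

/-- If every coset of an open nilpotent normal subgroup meets an open nilpotent subgroup, then
a term of the upper central series is open. -/
theorem exists_isOpen_upperCentralSeries [CompactSpace G] {N : Subgroup G} [N.Normal]
    (hNo : IsOpen (N : Set G)) (hN : Group.IsNilpotent N)
    (h : ∀ g : G, ∃ H : Subgroup G, IsOpen (H : Set G) ∧ Group.IsNilpotent H ∧
      ∃ n ∈ N, g * n ∈ H) :
    ∃ m, IsOpen (upperCentralSeries G m : Set G) := by
  have hfinite := N.quotient_finite_of_isOpen hNo
  have hfi : N.FiniteIndex := N.finiteIndex_of_finite_quotient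
  choose H hHo hHn n hnN hgn using h
  let W : Subgroup G := N ⊓ ⨅ q : G ⧸ N, H q.out
  have hWo : IsOpen (W : Set G) := by
    rw [coe_inf, coe_iInf]
    exact hNo.inter (isOpen_iInter_of_finite fun q => hHo _)
  have hVW : W.normalCore ≤ W := W.normalCore_le
  obtain ⟨m, hm⟩ := exists_le_upperCentralSeries (V := W.normalCore) (N := N)
    (hVW.trans inf_le_left) (fun g => by
      obtain ⟨c, hc⟩ := QuotientGroup.mk_out_eq_mul N g
      set q : G ⧸ N := QuotientGroup.mk g
      obtain ⟨d, hd⟩ := (isNilpotent_iff_lowerCentralSeries _).1 (hHn q.out)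
      -- The element `g * (c * n q.out)` equals `q.out * n q.out`, which lies in `H q.out`.
      refine ⟨c * n q.out, mul_mem c.2 (hnN _), d, fun v hv => ?_⟩
      have hvH : v ∈ H q.out := (iInf_le (fun q : G ⧸ N => H q.out) q) (hVW hv).2
      have := iterate_commutatorElement_mem_lowerCentralSeries (hgn q.out) hvH d
      rw [hd, mem_bot] at this
      rwa [← mul_assoc, ← hc])
  exact ⟨m, isOpen_mono hm (isOpen_normalCore hWo)⟩

end Topology

end Subgroup

/-! ### The equivalences for profinite groups -/

section Profinite

variable {G : Type*} [Group G] [TopologicalSpace G] [IsTopologicalGroup G]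

theorem CoveredByCountablyManyNilpotent.closed [T1Space G]
    (h : CoveredByCountablyManyNilpotent G) : CoveredByCountablyManyClosedNilpotent G := by
  obtain ⟨S, hS, hnil, hcov⟩ := h
  refine ⟨Subgroup.topologicalClosure '' S, hS.image _, ?_, fun g => ?_⟩
  · rintro _ ⟨H, hH, rfl⟩
    exact ⟨H.isClosed_topologicalClosure, Subgroup.isNilpotent_topologicalClosure (hnil H hH)⟩
  · obtain ⟨H, hH, hg⟩ := hcov g
    exact ⟨_, ⟨H, hH, rfl⟩, H.le_topologicalClosure hg⟩

theorem CoveredByCountablyManyClosedNilpotent.exists_isOpen_upperCentralSeries [CompactSpace G]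
    [T2Space G] (h : CoveredByCountablyManyClosedNilpotent G) :
    ∃ m, IsOpen (Subgroup.upperCentralSeries G m : Set G) := by
  obtain ⟨S, hS, hnil, hcov⟩ := h
  have hdense : Dense (⋃ H ∈ S, interior (H : Set G)) :=
    dense_biUnion_interior_of_closed (fun H hH => (hnil H hH).1) hS
      (Set.eq_univ_of_forall fun g => by simpa using hcov g)
  have key (U : Set G) (hU : IsOpen U) (hne : U.Nonempty) :
      ∃ H ∈ S, IsOpen (H : Set G) ∧ ∃ x ∈ U, x ∈ H := by
    obtain ⟨x, hxU, hx⟩ := hdense.inter_open_nonempty U hU hne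
    simp only [Set.mem_iUnion] at hx
    obtain ⟨H, hH, hx⟩ := hx
    exact ⟨H, hH, H.isOpen_of_mem_nhds (mem_interior_iff_mem_nhds.1 hx), x, hxU,
      interior_subset hx⟩
  obtain ⟨H₀, hH₀, hH₀o, -⟩ := key Set.univ isOpen_univ Set.univ_nonempty
  have hNo := Subgroup.isOpen_normalCore hH₀o
  refine Subgroup.exists_isOpen_upperCentralSeries hNo
    (Subgroup.isNilpotent_of_le H₀.normalCore_le (hnil H₀ hH₀).2) fun g => ?_
  -- Density applied to the open coset of `g`.
  obtain ⟨H, hH, hHo, x, ⟨n, hn, rfl⟩, hx⟩ := key ((g * ·) '' (H₀.normalCore : Set G))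
    (isOpenMap_mul_left g _ hNo) ⟨g * 1, 1, one_mem _, rfl⟩
  exact ⟨H, hHo, (hnil H hH).2, n, hn, hx⟩

theorem coveredByCountablyManyNilpotent_of_isOpen_upperCentralSeries [CompactSpace G] {m : ℕ}
    (hm : IsOpen (Subgroup.upperCentralSeries G m : Set G)) :
    CoveredByCountablyManyNilpotent G := by
  have := Subgroup.quotient_finite_of_isOpen _ hm
  refine ⟨Set.range fun q : G ⧸ Subgroup.upperCentralSeries G m =>
    Subgroup.zpowers q.out ⊔ Subgroup.upperCentralSeries G m, Set.countable_range _, ?_,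
    fun g => ⟨_, ⟨(g : G ⧸ Subgroup.upperCentralSeries G m), rfl⟩, ?_⟩⟩
  · rintro _ ⟨q, rfl⟩
    exact Subgroup.isNilpotent_zpowers_sup_upperCentralSeries _ m
  · obtain ⟨c, hc⟩ := QuotientGroup.mk_out_eq_mul (Subgroup.upperCentralSeries G m) g
    exact (mul_mem_cancel_right (Subgroup.mem_sup_right c.2)).1
      (hc ▸ Subgroup.mem_sup_left (Subgroup.mem_zpowers _))

theorem isFiniteByNilpotent_of_finiteIndex_upperCentralSeries {G : Type*} [Group G] {m : ℕ}
    (h : (Subgroup.upperCentralSeries G m).FiniteIndex) : IsFiniteByNilpotent G := by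
  refine ⟨(⊤ : Subgroup G).lowerCentralSeries m, inferInstance,
    Subgroup.finite_lowerCentralSeries_of_finiteIndex_upperCentralSeries m h, ?_⟩
  refine Subgroup.nilpotent_iff_lowerCentralSeries.2 ⟨m, ?_⟩
  rw [← Subgroup.map_top_of_surjective _ (QuotientGroup.mk'_surjective _),
    ← Subgroup.map_lowerCentralSeries, Subgroup.map_eq_bot_iff, QuotientGroup.ker_mk']

theorem IsFiniteByNilpotent.exists_isOpen_upperCentralSeries [CompactSpace G] [T2Space G]
    [TotallyDisconnectedSpace G] (h : IsFiniteByNilpotent G) :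
    ∃ m, IsOpen (Subgroup.upperCentralSeries G m : Set G) := by
  obtain ⟨N, hN, hfin, hnil⟩ := h
  obtain ⟨c, hc⟩ := Subgroup.nilpotent_iff_lowerCentralSeries.1 hnil
  rw [← Subgroup.map_top_of_surjective _ (QuotientGroup.mk'_surjective N),
    ← Subgroup.map_lowerCentralSeries, Subgroup.map_eq_bot_iff, QuotientGroup.ker_mk'] at hc
  -- This yields an open normal `U` with `U ⊓ N = ⊥`; `c` commutators with `G` send `U` into `U ⊓
  -- N`.
  have hopen : IsOpen ((N : Set G) \ {1})ᶜ :=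
    ((Set.toFinite (N : Set G)).subset Set.sdiff_subset).isClosed.isOpen_compl
  obtain ⟨U, hU⟩ := ProfiniteGrp.exist_openNormalSubgroup_sub_open_nhds_of_one hopen (by simp)
  refine ⟨c + 0, Subgroup.isOpen_mono
    (Subgroup.le_upperCentralSeries_of_iteratedCommutator_le ?_) U.isOpen⟩
  intro x hx
  have hxN : x ∈ N := hc (Subgroup.iteratedCommutator_le_lowerCentralSeries le_top c hx)
  have hxU : x ∈ U.toSubgroup := Subgroup.iteratedCommutator_le_left _ ⊤ c hx
  by_contra hx1
  exact hU hxU ⟨hxN, fun h => hx1 (h ▸ one_mem _)⟩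

end Profinite

theorem theorem1p2 (G : Type*) [Group G] [TopologicalSpace G] [IsTopologicalGroup G]
    [CompactSpace G] [T2Space G] [TotallyDisconnectedSpace G] :
    List.TFAE
      [CoveredByCountablyManyNilpotent G,
        CoveredByCountablyManyClosedNilpotent G,
        IsFiniteByNilpotent G,
        ∃ m : ℕ, 0 < m ∧ IsOpen (Subgroup.upperCentralSeries G m : Set G)] := by
  have hpos : (∃ m, IsOpen (Subgroup.upperCentralSeries G m : Set G)) →
      ∃ m : ℕ, 0 < m ∧ IsOpen (Subgroup.upperCentralSeries G m : Set G) := fun ⟨m, hm⟩ =>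
    ⟨m + 1, m.succ_pos, Subgroup.isOpen_mono (Subgroup.upperCentralSeries_mono G m.le_succ) hm⟩
  tfae_have 1 → 2 := fun h => h.closed
  tfae_have 2 → 4 := fun h => hpos h.exists_isOpen_upperCentralSeries
  tfae_have 4 → 1 := fun ⟨_, _, hm⟩ =>
    coveredByCountablyManyNilpotent_of_isOpen_upperCentralSeries hm
  tfae_have 4 → 3 := fun ⟨m, _, hm⟩ => by
    have := Subgroup.quotient_finite_of_isOpen _ hm
    exact isFiniteByNilpotent_of_finiteIndex_upperCentralSeries
      (Subgroup.finiteIndex_of_finite_quotient (H := Subgroup.upperCentralSeries G m))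
  tfae_have 3 → 4 := fun h => hpos h.exists_isOpen_upperCentralSeries
  tfae_finish
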